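/- **Setting.** Let $\Sigma$ be a finite alphabet and $\varepsilon$ the empty word; a word $x$ is a factor of $w$ if $w = yxz$ for some words $y,z\in\Sigma^*$. A nonempty word is *primitive* if it is not of the form $z^k$ with $z\in\Sigma^*$ and $k>1$. Two words are *conjugate* if they can be written as $xy$ and $yx$ with $x,y\in\Sigma^*$. Two words $u,v\in\Sigma^+$ are *co-primitive* if both are primitive and they are not conjugate. FC-formulas are built from atomic formulas $x \doteq y\cdot z$, where each of $x,y,z$ is a variable, a letter of $\Sigma$ or $\varepsilon$, by $\land,\lor,\neg$ and the quantifiers $\exists x,\forall x$. They are interpreted in a word $w\in\Sigma^*$ as follows: variables take factors of $w$ as values, and quantifiers range over all factors of $w$; the constant $\varepsilon$ denotes the empty word; a letter $\mathtt a$ denotes the word $\mathtt a$ if $\mathtt a$ occurs in $w$, and an extra null value $\bot$ otherwise; $x\doteq y\cdot z$ holds if the values of $x,y,z$ are all factors of $w$ (so none is $\bot$) and the value of $x$ is the concatenation of the values of $y$ and $z$. For a sentence $\varphi$ (a formula without free variables), $\mathcal L(\varphi)$ is the set of all $w\in\Sigma^*$ in which $\varphi$ holds. **Lemma (Fooling Lemma).**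 Let $w_1,w_2,w_3\in\Sigma^*$, let $u,v\in\Sigma^+$ be co-primitive, let $\varphi$ be an FC-sentence, and let $f\colon\mathbb N\to\mathbb N$ be injective, where $\mathbb N=\{0,1,2,\dots\}$. If $$w_1\, u^p\, w_2\, v^{f(p)}\, w_3\in\mathcal L(\varphi)\quad\text{for all } p\in\mathbb N,$$ then there are $s,t\in\mathbb N$ with $f(s)\neq t$ and $$w_1\, u^s\, w_2\, v^t\, w_3\in\mathcal L(\varphi).$$ -/

import Mathlib

/-! ## Words

Words over the alphabet `α` are lists over `α`; concatenation is `++`, the empty word is `[]`,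
and `u` is a factor of `w` if it is a contiguous sublist, `u <:+: w`. -/

/-- `wordPow w k` is the word consisting of `k` repetitions of `w`; in particular
`wordPow w 0 = []`. -/
def wordPow {α : Type*} (w : List α) (k : ℕ) : List α :=
  (List.replicate k w).flatten

/-- A word is primitive if it is nonempty and not of the form `z ^ k` with `k > 1`. -/
def IsPrimitiveWord {α : Type*} (w : List α) : Prop :=
  w ≠ [] ∧ ¬ ∃ (z : List α) (k : ℕ), 1 < k ∧ w = wordPow z k

/-- Two words are conjugate if they are of the form `x y` and `y x`. -/
def AreConjugate {α : Type*} (w v : List α) : Prop :=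
  ∃ x y : List α, w = x ++ y ∧ v = y ++ x

/-- Two words are co-primitive if both are primitive and they are not conjugate. -/
def CoPrimitive {α : Type*} (w v : List α) : Prop :=
  IsPrimitiveWord w ∧ IsPrimitiveWord v ∧ ¬ AreConjugate w v

/-! ## The logic FC -/

/-- Arguments of atomic formulas: variables (indexed by `ℕ`), a constant symbol for every letter
of the alphabet, and a constant symbol for the empty word. -/
inductive FCTerm (α : Type*) where
  | var (x : ℕ) : FCTerm α
  | letter (a : α) : FCTerm α
  | eps : FCTerm α

/-- FC-formulas. The atomic formula `atom x y z` stands for `x = y · z`. -/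
inductive FC (α : Type*) where
  | atom (x y z : FCTerm α) : FC α
  | and (φ ψ : FC α) : FC α
  | or (φ ψ : FC α) : FC α
  | not (φ : FC α) : FC α
  | all (x : ℕ) (φ : FC α) : FC α
  | ex (x : ℕ) (φ : FC α) : FC α

/-- The set of factors of the word `w`. -/
def Facs {α : Type*} (w : List α) : Set (List α) := {u | u <:+: w}

/-- The universe of the structure representing `w`: the factors of `w`, together with
the null value `⊥ = none`. -/
abbrev FCUniverse {α : Type*} (w : List α) : Type _ := Option (Facs w)

/-- The ternary relation of the structure representing `w`: concatenation, restricted to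
factors of `w`. It never holds if one of the arguments is `⊥`. -/
def FCConcat {α : Type*} (w : List α) (a b c : FCUniverse w) : Prop :=
  ∃ x y z : Facs w, a = some x ∧ b = some y ∧ c = some z ∧ x.1 = y.1 ++ z.1

/-- The empty word as a factor of `w`. -/
def epsFactor {α : Type*} (w : List α) : Facs w :=
  ⟨[], List.nil_infix⟩

open Classical in
/-- The interpretation of the constant symbol of the letter `a` in the structure representing `w`:
the word `a` if `a` occurs in `w`, and `⊥` otherwise. -/
noncomputable def letterConst {α : Type*} (w : List α) (a : α) : FCUniverse w :=
  if h : [a] <:+: w then some ⟨[a], h⟩ else none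

namespace FCTerm

/-- The value of a term in the structure representing `w`, where the values of the variables
(which are factors of `w`, never `⊥`) are given by `σ`. -/
noncomputable def val {α : Type*} (w : List α) (σ : ℕ → Facs w) : FCTerm α → FCUniverse w
  | var x => some (σ x)
  | letter a => letterConst w a
  | eps => some (epsFactor w)

/-- The variables occurring in a term. -/
def vars {α : Type*} : FCTerm α → Finset ℕ
  | var x => {x}
  | letter _ => ∅
  | eps => ∅

end FCTerm

namespace FC

/-- Satisfaction of an FC-formula in the structure representing `w` under the assignment `σ`;
quantifiers range over the factors of `w`. -/
def Sat {α : Type*} (w : List α) : (ℕ → Facs w) → FC α → Prop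
  | σ, atom x y z => FCConcat w (x.val w σ) (y.val w σ) (z.val w σ)
  | σ, and φ ψ => Sat w σ φ ∧ Sat w σ ψ
  | σ, or φ ψ => Sat w σ φ ∨ Sat w σ ψ
  | σ, not φ => ¬ Sat w σ φ
  | σ, all x φ => ∀ u : Facs w, Sat w (Function.update σ x u) φ
  | σ, ex x φ => ∃ u : Facs w, Sat w (Function.update σ x u) φ

/-- The free variables of an FC-formula. -/
def freeVars {α : Type*} : FC α → Finset ℕ
  | atom x y z => x.vars ∪ y.vars ∪ z.vars
  | and φ ψ => φ.freeVars ∪ ψ.freeVars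
  | or φ ψ => φ.freeVars ∪ ψ.freeVars
  | not φ => φ.freeVars
  | all x φ => φ.freeVars.erase x
  | ex x φ => φ.freeVars.erase x

/-- A sentence is a formula without free variables. -/
def IsSentence {α : Type*} (φ : FC α) : Prop := φ.freeVars = ∅

/-- The language of a sentence: the set of all words whose structure satisfies it (for a sentence,
the assignment is immaterial, see `FC.mem_language_iff`). -/
def language {α : Type*} (φ : FC α) : Set (List α) :=
  {w | ∀ σ : ℕ → Facs w, Sat w σ φ}

theorem val_congr {α : Type*} {w : List α} {σ τ : ℕ → Facs w} (t : FCTerm α)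
    (h : ∀ x ∈ t.vars, σ x = τ x) : t.val w σ = t.val w τ := by
  cases t with
  | var x => simp [FCTerm.val, h x (by simp [FCTerm.vars])]
  | letter a => rfl
  | eps => rfl

/-- Satisfaction only depends on the values of the free variables. -/
theorem sat_congr {α : Type*} {w : List α} (φ : FC α) : ∀ {σ τ : ℕ → Facs w},
    (∀ x ∈ φ.freeVars, σ x = τ x) → (Sat w σ φ ↔ Sat w τ φ) := by
  have key : ∀ (x : ℕ) (φ : FC α) (σ τ : ℕ → Facs w) (u : Facs w),
      (∀ y ∈ φ.freeVars.erase x, σ y = τ y) →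
      ∀ y ∈ φ.freeVars, Function.update σ x u y = Function.update τ x u y := by
    intro x φ σ τ u h y hy
    by_cases hxy : y = x
    · subst hxy; simp
    · simp [Function.update_of_ne hxy, h y (Finset.mem_erase.2 ⟨hxy, hy⟩)]
  induction φ with
  | atom x y z =>
    intro σ τ h
    simp only [freeVars, Finset.mem_union] at h
    simp only [Sat]
    rw [val_congr x fun i hi => h i (Or.inl (Or.inl hi)),
      val_congr y fun i hi => h i (Or.inl (Or.inr hi)), val_congr z fun i hi => h i (Or.inr hi)]
  | and φ ψ h₁ h₂ =>
    intro σ τ h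
    simp only [freeVars, Finset.mem_union] at h
    exact and_congr (h₁ fun x hx => h x (Or.inl hx)) (h₂ fun x hx => h x (Or.inr hx))
  | or φ ψ h₁ h₂ =>
    intro σ τ h
    simp only [freeVars, Finset.mem_union] at h
    exact or_congr (h₁ fun x hx => h x (Or.inl hx)) (h₂ fun x hx => h x (Or.inr hx))
  | not φ h₁ =>
    intro σ τ h
    exact not_congr (h₁ h)
  | all x φ h₁ =>
    intro σ τ h
    exact forall_congr' fun u => h₁ (key x φ σ τ u h)
  | ex x φ h₁ =>
    intro σ τ h
    exact exists_congr fun u => h₁ (key x φ σ τ u h)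

/-- For a sentence, membership in the language can be tested with any single assignment. -/
theorem mem_language_iff {α : Type*} {φ : FC α} (hφ : φ.IsSentence) {w : List α}
    (σ : ℕ → Facs w) : w ∈ φ.language ↔ Sat w σ φ := by
  refine ⟨fun h => h σ, fun h τ => (sat_congr φ ?_).1 h⟩
  rw [IsSentence] at hφ
  simp [hφ]

end FC

/-!
The word `w₁ uᵖ w₂ vᵐ w₃` is cut into `x = w₁ uᵖ w₂` and `y = vᵐ w₃`. As `u` and `v` are co-primitive,
the theorem of Fine and Wilf bounds the length of the common factors of `x` and `y` by a number `r`
that depends neither on `p` nor on `m` (`CoPrimitive.length_le_of_infix_append`).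

Assignments of factors of `x` to finitely many variables have a type of rank `n` (`rankType`), the
usual description of Ehrenfeucht-Fraïssé games, where the atomic types record the equations
`a e = b s c d` between values `a`, `b`, `c` up to words `e`, `s`, `d` of length at most `r`, and which
values are suffixes of `x`. There are only finitely many types of a given rank, so for every `n` the
words `w₁ uᵖ w₂` and `w₁ u^q w₂` have the same type of rank `n` for some `p ≠ q`.

For two words `x`, `x'` of the same type, the games on `x y` and `x' y` are equivalent
(`FC.sat_append_iff`): a factor of `x y` is a product `z₁ z₂` of factors of `x` and of `y`; the answer
is `z₁' z₂`, where `z₁'` answers `z₁` in the game on `x` and `x'`. Concatenations are preserved by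
`append_eq_transfer`: in an equation `a₁ a₂ = (b₁ b₂) (c₁ c₂)` every overlap of a factor of `x` with a
factor of `y` is a common factor, hence short, and so the equation amounts to one that
the atomic type records. Applied to `y = vᵐ w₃` with `m = f p`, this gives the word
`w₁ u^q w₂ v^(f p) w₃` in the language, and `f q ≠ f p` by injectivity.
-/

/-! ### Powers of primitive words -/

@[simp] theorem length_wordPow {α : Type*} (w : List α) (k : ℕ) :
    (wordPow w k).length = k * w.length := by
  simp [wordPow]

theorem getElem?_wordPow {α : Type*} (w : List α) (k i : ℕ) (hi : i < k * w.length) :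
    (wordPow w k)[i]? = w[i % w.length]? := by
  induction k generalizing i with
  | zero => simp at hi
  | succ k ih =>
    have hsucc : wordPow w (k + 1) = w ++ wordPow w k := by
      simp [wordPow, List.replicate_succ]
    rw [hsucc]
    by_cases h : i < w.length
    · rw [List.getElem?_append_left h, Nat.mod_eq_of_lt h]
    · push Not at h
      rw [List.getElem?_append_right h, ih, ← Nat.mod_eq_sub_mod h]
      rw [Nat.succ_mul] at hi
      omega

/-- A factor of a power of `w` reads the cyclic word `w`, from some starting point `c` on. -/
theorem exists_getElem?_of_infix_wordPow {α : Type*} {s w : List α} {k : ℕ}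
    (h : s <:+: wordPow w k) :
    ∃ c, ∀ i < s.length, s[i]? = w[(c + i) % w.length]? := by
  obtain ⟨l, r, h⟩ := h
  refine ⟨l.length, fun i hi => ?_⟩
  have hlen := congrArg List.length h
  simp only [List.length_append, length_wordPow] at hlen
  rw [← getElem?_wordPow w k _ (by omega), ← h, List.append_assoc,
    List.getElem?_append_right (by omega), List.getElem?_append_left (by omega)]
  congr 1
  omega

/-- A primitive word whose cyclic reading, over at least two turns, has a period `g` dividing
its length, has length `g`. -/
theorem IsPrimitiveWord.length_eq_of_hasPeriod {α : Type*} {u s : List α}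
    (hu : IsPrimitiveWord u) {c g : ℕ} (hg : g ∣ u.length) (hs : 2 * u.length ≤ s.length)
    (hc : ∀ i < s.length, s[i]? = u[(c + i) % u.length]?) (hper : s.HasPeriod g) :
    u.length = g := by
  have hpos : 0 < u.length := List.length_pos_iff.2 hu.1
  have hgpos : 0 < g := Nat.pos_of_dvd_of_pos hg hpos
  have hcm : c % u.length < u.length := Nat.mod_lt _ hpos
  have hread : ∀ j < u.length, s[j + (u.length - c % u.length)]? = u[j]? := by
    intro j hj
    rw [hc _ (by omega)]
    congr 1
    have : c + (j + (u.length - c % u.length)) = j + u.length * (c / u.length + 1) := by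
      have := Nat.mod_add_div c u.length
      rw [Nat.mul_add]
      omega
    rw [this, Nat.add_mul_mod_self_left, Nat.mod_eq_of_lt hj]
  have hmod : ∀ j < u.length, u[j]? = u[j % g]? := by
    intro j hj
    have hjg : j % g ≤ j := Nat.mod_le _ _
    rw [← hread j hj, ← hread (j % g) (by omega), ← hper.getElem?_mod _ _ _ (by omega),
      ← hper.getElem?_mod g (j % g + _) _ (by omega), Nat.mod_add_mod]
  obtain ⟨k, hk⟩ := hg
  by_contra hne
  have hk1 : 1 < k := by
    rcases k with _ | _ | k
    · omega
    · omega
    · omega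
  have hgu : g ≤ u.length := Nat.le_of_dvd hpos ⟨k, hk⟩
  have htl : (u.take g).length = g := by simp [hgu]
  refine hu.2 ⟨u.take g, k, hk1, List.ext_getElem? fun i => ?_⟩
  by_cases hi : i < u.length
  · rw [getElem?_wordPow _ _ _ (by rw [htl, Nat.mul_comm, ← hk]; exact hi), htl,
      List.getElem?_take_of_lt (Nat.mod_lt _ hgpos), hmod i hi]
  · rw [List.getElem?_eq_none (by omega), List.getElem?_eq_none]
    rw [length_wordPow, htl, Nat.mul_comm, ← hk]
    omega

/-- Powers of co-primitive words only have short factors in common: a long common factor has both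
lengths as periods, hence also their greatest common divisor by the theorem of Fine and Wilf, so
that by primitivity the lengths agree and both words are read off the same cyclic word. -/
theorem CoPrimitive.length_lt_of_infix {α : Type*} {u v s : List α} (huv : CoPrimitive u v)
    {p m : ℕ} (hsu : s <:+: wordPow u p) (hsv : s <:+: wordPow v m) :
    s.length < 2 * (u.length + v.length) := by
  obtain ⟨hu, hv, hconj⟩ := huv
  by_contra! hlen
  obtain ⟨c, hc⟩ := exists_getElem?_of_infix_wordPow hsu
  obtain ⟨d, hd⟩ := exists_getElem?_of_infix_wordPow hsv
  have hpu : s.HasPeriod u.length := List.hasPeriod_iff_getElem?.2 fun i hi => by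
    rw [hc i (by omega), hc (i + u.length) (by omega), ← Nat.add_assoc, Nat.add_mod_right]
  have hpv : s.HasPeriod v.length := List.hasPeriod_iff_getElem?.2 fun i hi => by
    rw [hd i (by omega), hd (i + v.length) (by omega), ← Nat.add_assoc, Nat.add_mod_right]
  have hper := hpu.gcd hpv (by omega)
  have hgu := hu.length_eq_of_hasPeriod (Nat.gcd_dvd_left _ _) (by omega) hc hper
  have hgv := hv.length_eq_of_hasPeriod (Nat.gcd_dvd_right _ _) (by omega) hd hper
  have hl : u.length = v.length := hgu.trans hgv.symm
  have hpos : 0 < u.length := List.length_pos_iff.2 hu.1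
  have hrot : u.rotate c = v.rotate d := by
    refine List.ext_getElem? fun i => ?_
    by_cases hi : i < u.length
    · rw [List.getElem?_rotate hi, List.getElem?_rotate (hl ▸ hi), Nat.add_comm i c,
        Nat.add_comm i d, ← hc i (by omega), ← hd i (by omega)]
    · rw [List.getElem?_eq_none (by simpa using hi),
        List.getElem?_eq_none (by rw [List.length_rotate]; omega)]
  have hr : u.IsRotated v := .trans ⟨c, hrot⟩ (List.IsRotated.symm ⟨d, rfl⟩)
  obtain ⟨n, hn, h⟩ := List.isRotated_iff_mod.1 hr
  exact hconj ⟨u.take n, u.drop n, by simp, by rw [← h, List.rotate_eq_drop_append_take hn]⟩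

/-! ### Factors of a concatenation -/

theorem infix_append_cases {α : Type*} {z x y : List α} (h : z <:+: x ++ y) :
    ∃ z₁ z₂, z = z₁ ++ z₂ ∧ z₁ <:+: x ∧ z₂ <:+: y ∧
      (z₁ = [] ∨ z₂ = [] ∨ (z₁ <:+ x ∧ z₂ <+: y)) := by
  obtain ⟨l, r, h⟩ := h
  rw [List.append_assoc, List.append_eq_append_iff] at h
  rcases h with ⟨a, rfl, h⟩ | ⟨b, rfl, rfl⟩
  · rcases List.append_eq_append_iff.1 h with ⟨e, rfl, rfl⟩ | ⟨e, rfl, rfl⟩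
    · exact ⟨z, [], by simp, ⟨l, e, by simp⟩, List.nil_infix, Or.inr (Or.inl rfl)⟩
    · exact ⟨a, e, rfl, ⟨l, [], by simp⟩, ⟨[], r, by simp⟩,
        Or.inr (Or.inr ⟨⟨l, rfl⟩, ⟨r, rfl⟩⟩)⟩
  · exact ⟨[], z, rfl, List.nil_infix, ⟨b, r, by simp⟩, Or.inl rfl⟩

theorem append_infix_append {α : Type*} {z₁ z₂ x y : List α} (h₁ : z₁ <:+: x) (h₂ : z₂ <:+: y)
    (h : z₁ = [] ∨ z₂ = [] ∨ (z₁ <:+ x ∧ z₂ <+: y)) : z₁ ++ z₂ <:+: x ++ y := by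
  rcases h with rfl | rfl | ⟨⟨l, rfl⟩, ⟨r, rfl⟩⟩
  · simpa using h₂.trans (List.suffix_append x y).isInfix
  · simpa using h₁.trans (List.prefix_append x y).isInfix
  · exact ⟨l, r, by simp⟩

/-- The factors that `w₁ uᵖ w₂` and `vᵐ w₃` have in common are of length bounded independently
of `p` and `m`. -/
theorem CoPrimitive.length_le_of_infix_append {α : Type*} {u v s : List α}
    (huv : CoPrimitive u v) (w₁ w₂ w₃ : List α) {p m : ℕ}
    (h₁ : s <:+: w₁ ++ wordPow u p ++ w₂) (h₂ : s <:+: wordPow v m ++ w₃) :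
    s.length ≤ w₁.length + w₂.length + w₃.length + 2 * (u.length + v.length) := by
  obtain ⟨s', s₃, rfl, hs', hs₃, -⟩ := infix_append_cases h₁
  obtain ⟨s₁, s₂, rfl, hs₁, hs₂, -⟩ := infix_append_cases hs'
  have h : s₂ <:+: wordPow v m ++ w₃ := .trans ⟨s₁, s₃, rfl⟩ h₂
  obtain ⟨t₁, t₂, rfl, ht₁, ht₂, -⟩ := infix_append_cases h
  have hlt := huv.length_lt_of_infix (.trans (List.prefix_append t₁ t₂).isInfix hs₂) ht₁
  have := hs₁.length_le
  have := hs₃.length_le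
  have := ht₂.length_le
  simp only [List.length_append]
  omega

/-- If the word `x` has only short factors in common with `a₂`, `b₂` and `c₂`, then the equation
`a₁ a₂ = b₁ b₂ c₁ c₂` for factors `a₁`, `b₁`, `c₁` of `x` only depends on equations between
`a₁`, `b₁`, `c₁` and short words: wherever `a₁` ends on the right-hand side, all pieces along which
a factor of `x` meets one of `a₂`, `b₂`, `c₂` are short. -/
theorem append_eq_transfer {α : Type*} {r : ℕ} {x a₁ b₁ c₁ a₁' b₁' c₁' a₂ b₂ c₂ : List α}
    (ha : a₁ <:+: x) (hb : b₁ <:+: x) (hc : c₁ <:+: x)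
    (hgap_a : ∀ s, s <:+: x → s <:+: a₂ → s.length ≤ r)
    (hgap_b : ∀ s, s <:+: x → s <:+: b₂ → s.length ≤ r)
    (hgap_c : ∀ s, s <:+: x → s <:+: c₂ → s.length ≤ r)
    (hword : ∀ s : List α, s.length ≤ r → c₁ = s → c₁' = s)
    (hba : ∀ s : List α, s.length ≤ r → b₁ = a₁ ++ s → b₁' = a₁' ++ s)
    (hab : ∀ s : List α, s.length ≤ r → a₁ = b₁ ++ s → a₁' = b₁' ++ s)
    (habc : ∀ e s d : List α, e.length ≤ r → s.length ≤ r → d.length ≤ r →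
      a₁ ++ e = b₁ ++ s ++ c₁ ++ d → a₁' ++ e = b₁' ++ s ++ c₁' ++ d)
    (h : a₁ ++ a₂ = b₁ ++ b₂ ++ (c₁ ++ c₂)) :
    a₁' ++ a₂ = b₁' ++ b₂ ++ (c₁' ++ c₂) := by
  rw [List.append_assoc] at h
  -- The four cases according to which of `b₁`, `b₂`, `c₁`, `c₂` contains the end of `a₁`.
  rcases List.append_eq_append_iff.1 h with ⟨e, hb₁, ha₂⟩ | ⟨d, ha₁, h⟩
  · have he := hgap_a e (.trans ⟨a₁, [], by simp [hb₁]⟩ hb) ⟨[], _, by simp [ha₂]; rfl⟩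
    have hcl := hgap_a c₁ hc ⟨e ++ b₂, c₂, by simp [ha₂]⟩
    rw [hba e he hb₁, hword _ hcl rfl, ha₂]
    simp
  rcases List.append_eq_append_iff.1 h with ⟨e, hd, h⟩ | ⟨e, hb₂, ha₂⟩
  · rcases List.append_eq_append_iff.1 h with ⟨f, he, hc₂⟩ | ⟨f, hc₁, ha₂⟩
    · have hbl := hgap_b b₂ (.trans ⟨b₁, e, by simp [ha₁, hd]⟩ ha) List.infix_rfl
      have hfl := hgap_c f (.trans ⟨b₁ ++ b₂ ++ c₁, [], by simp [ha₁, hd, he]⟩ ha)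
        ⟨[], a₂, by simp [hc₂]⟩
      have := habc [] b₂ f (by simp) hbl hfl (by simp [ha₁, hd, he])
      rw [List.append_nil] at this
      rw [this, hc₂]
      simp
    · have hbl := hgap_b b₂ (.trans ⟨b₁, e, by simp [ha₁, hd]⟩ ha) List.infix_rfl
      have hfl := hgap_a f (.trans ⟨e, [], by simp [hc₁]⟩ hc) ⟨[], c₂, by simp [ha₂]⟩
      have := habc f b₂ [] hfl hbl (by simp) (by simp [ha₁, hd, hc₁])
      rw [ha₂, ← List.append_assoc, this]
      simp
  · have hdl := hgap_b d (.trans ⟨b₁, [], by simp [ha₁]⟩ ha) ⟨[], e, by simp [hb₂]⟩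
    have hcl := hgap_a c₁ hc ⟨e, c₂, by simp [ha₂]⟩
    rw [hab d hdl ha₁, hword _ hcl rfl, ha₂, hb₂]
    simp

/-! ### Types of assignments -/

/-- The words of length at most `r`. -/
abbrev ShortWord (α : Type*) (r : ℕ) : Type _ := {s : List α // s.length ≤ r}

instance {α : Type*} [Finite α] (r : ℕ) : Finite (ShortWord α r) :=
  (List.finite_length_le α r).to_subtype

/-- The first `N` values of the assignment `τ`, together with the empty word as the value
at `none`. -/
def pebbles {α : Type*} (N : ℕ) (τ : ℕ → List α) : Option (Fin N) → List α
  | none => []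
  | some i => τ i

/-- Possible atomic types of assignments of words to the variables below `N`. -/
abbrev AtomicType (α : Type*) (N r : ℕ) : Type _ :=
  Set ((Option (Fin N) × Option (Fin N) × Option (Fin N)) ×
    ShortWord α r × ShortWord α r × ShortWord α r) × Set (Fin N) × Set α

/-- The atomic type of an assignment `τ` of factors of `x`: the valid equations `a e = b s c d` for
values `a`, `b`, `c` and words `e`, `s`, `d` of length at most `r`, the variables whose value is a
suffix of `x`, and the letters of `x`. -/
def atomicType {α : Type*} (N r : ℕ) (x : List α) (τ : ℕ → List α) : AtomicType α N r :=
  ({q | pebbles N τ q.1.1 ++ q.2.1.1 =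
      pebbles N τ q.1.2.1 ++ q.2.2.1.1 ++ pebbles N τ q.1.2.2 ++ q.2.2.2.1},
    {i | τ i <:+ x}, {a | a ∈ x})

/-- Possible types of rank `n`. -/
def RankType (α : Type*) (N r : ℕ) : ℕ → Type _
  | 0 => AtomicType α N r
  | n + 1 => AtomicType α N r × (Fin N → Set (RankType α N r n))

instance RankType.finite {α : Type*} [Finite α] (N r : ℕ) : ∀ n, Finite (RankType α N r n)
  | 0 => inferInstanceAs (Finite (AtomicType α N r))
  | n + 1 =>
    have := RankType.finite (α := α) N r n
    inferInstanceAs (Finite (AtomicType α N r × (Fin N → Set (RankType α N r n))))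

/-- The type of rank `n` of an assignment `τ` of factors of `x`. Equality of the types of rank `n`
means that the duplicator wins the `n`-round game, with respect to atomic types, in which the
players reassign the variables below `N`. -/
def rankType {α : Type*} (N r : ℕ) (x : List α) : (n : ℕ) → (ℕ → List α) → RankType α N r n
  | 0, τ => atomicType N r x τ
  | n + 1, τ => (atomicType N r x τ,
      fun i => {t | ∃ z, z <:+: x ∧ t = rankType N r x n (Function.update τ i z)})

section

variable {α : Type*} {N r n : ℕ} {x x' : List α} {τ τ' : ℕ → List α}

theorem atomicType_eq_of_rankType_eq (h : rankType N r x n τ = rankType N r x' n τ') :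
    atomicType N r x τ = atomicType N r x' τ' := by
  cases n with
  | zero => exact h
  | succ n => exact congrArg Prod.fst h

theorem exists_rankType_update_eq (h : rankType N r x (n + 1) τ = rankType N r x' (n + 1) τ')
    {i : ℕ} (hi : i < N) {z : List α} (hz : z <:+: x) :
    ∃ z', z' <:+: x' ∧ rankType N r x n (Function.update τ i z) =
      rankType N r x' n (Function.update τ' i z') := by
  have h' := congrFun (congrArg Prod.snd h) ⟨i, hi⟩
  exact h'.subset ⟨z, hz, rfl⟩

theorem pebbles_eq_transfer (h : atomicType N r x τ = atomicType N r x' τ')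
    (i j k : Option (Fin N)) {e s d : List α} (he : e.length ≤ r) (hs : s.length ≤ r)
    (hd : d.length ≤ r)
    (heq : pebbles N τ i ++ e = pebbles N τ j ++ s ++ pebbles N τ k ++ d) :
    pebbles N τ' i ++ e = pebbles N τ' j ++ s ++ pebbles N τ' k ++ d :=
  (Set.ext_iff.1 (congrArg Prod.fst h) ((i, j, k), ⟨e, he⟩, ⟨s, hs⟩, ⟨d, hd⟩)).1 heq

theorem suffix_transfer (h : atomicType N r x τ = atomicType N r x' τ') {i : ℕ} (hi : i < N)
    (hx : τ i <:+ x) : τ' i <:+ x' :=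
  (Set.ext_iff.1 (congrArg (fun t => t.2.1) h) ⟨i, hi⟩).1 hx

theorem mem_iff_mem (h : atomicType N r x τ = atomicType N r x' τ') (a : α) :
    a ∈ x ↔ a ∈ x' :=
  Set.ext_iff.1 (congrArg (fun t => t.2.2) h) a

theorem eq_nil_transfer (h : atomicType N r x τ = atomicType N r x' τ') {i : ℕ} (hi : i < N)
    (hx : τ i = []) : τ' i = [] := by
  simpa [pebbles] using pebbles_eq_transfer h (some ⟨i, hi⟩) none none (Nat.zero_le r)
    (Nat.zero_le r) (Nat.zero_le r) (e := []) (s := []) (d := []) (by simpa [pebbles] using hx)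

end

/-! ### Atomic formulas -/

namespace FCTerm

variable {α : Type*}

/-- All variables of the term are below `N`. -/
def Below (N : ℕ) : FCTerm α → Prop
  | var i => i < N
  | letter _ => True
  | eps => True

/-- The value of the term in `w` is not `⊥`. -/
def Defined (w : List α) : FCTerm α → Prop
  | var _ => True
  | letter a => a ∈ w
  | eps => True

/-- The value of a term as a word, regardless of the letters that occur in the ambient word. -/
def word (σ : ℕ → List α) : FCTerm α → List α
  | var i => σ i
  | letter a => [a]
  | eps => []

/-- The first component of the term when variables take the values `τ i ++ ρ i`; constants are
regarded as having empty first component. -/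
def left (τ : ℕ → List α) : FCTerm α → List α
  | var i => τ i
  | letter _ => []
  | eps => []

theorem word_append (τ ρ : ℕ → List α) (t : FCTerm α) :
    t.word (fun i => τ i ++ ρ i) = t.left τ ++ t.word ρ := by
  cases t <;> simp [word, left]

theorem val_eq_some_iff {w : List α} (σ : ℕ → Facs w) (t : FCTerm α) (u : Facs w) :
    t.val w σ = some u ↔ t.Defined w ∧ t.word (fun i => (σ i).1) = u.1 := by
  cases t with
  | var i => simp [val, Defined, word, Subtype.ext_iff]
  | eps => simp [val, Defined, word, epsFactor, Subtype.ext_iff]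
  | letter a =>
    by_cases h : a ∈ w <;>
      simp [val, Defined, word, letterConst, List.singleton_infix_iff, h, Subtype.ext_iff]

theorem word_infix {w : List α} (σ : ℕ → Facs w) {t : FCTerm α} (h : t.Defined w) :
    t.word (fun i => (σ i).1) <:+: w := by
  cases t with
  | var i => exact (σ i).2
  | eps => exact List.nil_infix
  | letter a => exact (List.singleton_infix_iff a w).2 h

theorem exists_left_eq_pebbles {N : ℕ} {t : FCTerm α} (ht : t.Below N) :
    ∃ o : Option (Fin N), ∀ τ, t.left τ = pebbles N τ o := by
  cases t with
  | var i => exact ⟨some ⟨i, ht⟩, fun _ => rfl⟩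
  | letter a => exact ⟨none, fun _ => rfl⟩
  | eps => exact ⟨none, fun _ => rfl⟩

theorem defined_append_iff {w w' y : List α} (h : ∀ a, a ∈ w ↔ a ∈ w') (t : FCTerm α) :
    t.Defined (w ++ y) ↔ t.Defined (w' ++ y) := by
  cases t <;> simp [Defined, h]

end FCTerm

theorem fcConcat_val_iff {α : Type*} {w : List α} (σ : ℕ → Facs w) (s t t' : FCTerm α) :
    FCConcat w (s.val w σ) (t.val w σ) (t'.val w σ) ↔
      s.Defined w ∧ t.Defined w ∧ t'.Defined w ∧ s.word (fun i => (σ i).1) =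
        t.word (fun i => (σ i).1) ++ t'.word (fun i => (σ i).1) := by
  simp only [FCConcat, FCTerm.val_eq_some_iff]
  constructor
  · rintro ⟨a, b, c, ⟨hs, ha⟩, ⟨ht, hb⟩, ⟨ht', hc⟩, h⟩
    exact ⟨hs, ht, ht', by rw [ha, hb, hc, h]⟩
  · rintro ⟨hs, ht, ht', h⟩
    exact ⟨⟨_, FCTerm.word_infix σ hs⟩, ⟨_, FCTerm.word_infix σ ht⟩,
      ⟨_, FCTerm.word_infix σ ht'⟩, ⟨hs, rfl⟩, ⟨ht, rfl⟩, ⟨ht', rfl⟩, h⟩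

/-! ### Composition -/

/-- The assignment `σ` of factors of `x ++ y` takes the values `τ i ++ ρ i`, with factors `τ i`
of `x` and `ρ i` of `y`. -/
structure SplitsAs {α : Type*} {x y : List α} (σ : ℕ → Facs (x ++ y)) (τ ρ : ℕ → List α) :
    Prop where
  val_eq : ∀ i, (σ i).1 = τ i ++ ρ i
  left_infix : ∀ i, τ i <:+: x
  right_infix : ∀ i, ρ i <:+: y

section

variable {α : Type*} {N r n : ℕ} {x x' y : List α} {τ τ' ρ : ℕ → List α}
  {σ : ℕ → Facs (x ++ y)} {σ' : ℕ → Facs (x' ++ y)}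

theorem SplitsAs.update (h : SplitsAs σ τ ρ) (i : ℕ) {z : Facs (x ++ y)} {z₁ z₂ : List α}
    (hz : z.1 = z₁ ++ z₂) (h₁ : z₁ <:+: x) (h₂ : z₂ <:+: y) :
    SplitsAs (Function.update σ i z) (Function.update τ i z₁) (Function.update ρ i z₂) := by
  refine ⟨fun j => ?_, fun j => ?_, fun j => ?_⟩ <;> by_cases hj : j = i
  · subst hj; simpa using hz
  · simpa [hj] using h.val_eq j
  · subst hj; simpa using h₁
  · simpa [hj] using h.left_infix j
  · subst hj; simpa using h₂
  · simpa [hj] using h.right_infix j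

theorem SplitsAs.fcConcat_transfer (hr : 1 ≤ r)
    (hgap : ∀ s, s <:+: x → s <:+: y → s.length ≤ r) (h : SplitsAs σ τ ρ)
    (h' : SplitsAs σ' τ' ρ) (htype : atomicType N r x τ = atomicType N r x' τ')
    {a b c : FCTerm α} (ha : a.Below N) (hb : b.Below N) (hc : c.Below N)
    (hconcat : FCConcat (x ++ y) (a.val _ σ) (b.val _ σ) (c.val _ σ)) :
    FCConcat (x' ++ y) (a.val _ σ') (b.val _ σ') (c.val _ σ') := by
  rw [fcConcat_val_iff] at hconcat ⊢
  obtain ⟨hda, hdb, hdc, heq⟩ := hconcat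
  have hdef := FCTerm.defined_append_iff (y := y) (mem_iff_mem htype)
  refine ⟨(hdef a).1 hda, (hdef b).1 hdb, (hdef c).1 hdc, ?_⟩
  simp only [h.val_eq, FCTerm.word_append] at heq
  simp only [h'.val_eq, FCTerm.word_append]
  have hleft : ∀ t : FCTerm α, t.left τ <:+: x := fun t => by
    cases t <;> simp [FCTerm.left, h.left_infix]
  have hgapt : ∀ t : FCTerm α, ∀ s, s <:+: x → s <:+: t.word ρ → s.length ≤ r := by
    intro t s hsx hs
    cases t with
    | var i => exact hgap s hsx (hs.trans (h.right_infix i))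
    | letter a => exact hs.length_le.trans hr
    | eps => exact hs.length_le.trans (Nat.zero_le r)
  obtain ⟨i, hi⟩ := FCTerm.exists_left_eq_pebbles ha
  obtain ⟨j, hj⟩ := FCTerm.exists_left_eq_pebbles hb
  obtain ⟨k, hk⟩ := FCTerm.exists_left_eq_pebbles hc
  have h0 : ([] : List α).length ≤ r := Nat.zero_le r
  refine append_eq_transfer (hleft a) (hleft b) (hleft c) (hgapt a) (hgapt b) (hgapt c)
    (fun s hs hcs => ?_) (fun s hs hba => ?_) (fun s hs hab => ?_)
    (fun e s d he hs hd habc => ?_) heq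
  · rw [hk] at hcs ⊢
    simpa [pebbles] using pebbles_eq_transfer htype k none none h0 hs h0
      (by simpa [pebbles] using hcs)
  · rw [hi, hj] at hba ⊢
    simpa [pebbles] using pebbles_eq_transfer htype j i none h0 hs h0
      (by simpa [pebbles] using hba)
  · rw [hi, hj] at hab ⊢
    simpa [pebbles] using pebbles_eq_transfer htype i j none h0 hs h0
      (by simpa [pebbles] using hab)
  · rw [hi, hj, hk] at habc ⊢
    exact pebbles_eq_transfer htype i j k he hs hd habc

/-- One round of the game on `x y` and `x' y`: only the part of the new factor in `x` is answered
in `x'`, the part in `y` is kept. -/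
theorem SplitsAs.exists_update (h : SplitsAs σ τ ρ) (h' : SplitsAs σ' τ' ρ)
    (htype : rankType N r x (n + 1) τ = rankType N r x' (n + 1) τ') {i : ℕ} (hi : i < N)
    (z : Facs (x ++ y)) :
    ∃ (z' : Facs (x' ++ y)) (τ₁ τ₁' ρ₁ : ℕ → List α),
      SplitsAs (Function.update σ i z) τ₁ ρ₁ ∧ SplitsAs (Function.update σ' i z') τ₁' ρ₁ ∧
        rankType N r x n τ₁ = rankType N r x' n τ₁' := by
  obtain ⟨z₁, z₂, hz, h₁, h₂, hcases⟩ := infix_append_cases z.2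
  obtain ⟨z₁', h₁', ht⟩ := exists_rankType_update_eq htype hi h₁
  have hat := atomicType_eq_of_rankType_eq ht
  have hcases' : z₁' = [] ∨ z₂ = [] ∨ (z₁' <:+ x' ∧ z₂ <+: y) := by
    rcases hcases with hnil | hnil | ⟨hs, hp⟩
    · exact Or.inl (by simpa using eq_nil_transfer hat hi (by simpa using hnil))
    · exact Or.inr (Or.inl hnil)
    · exact Or.inr (Or.inr ⟨by simpa using suffix_transfer hat hi (by simpa using hs), hp⟩)
  exact ⟨⟨_, append_infix_append h₁' h₂ hcases'⟩, _, _, _, h.update i hz h₁ h₂,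
    h'.update i rfl h₁' h₂, ht⟩

end

namespace FC

variable {α : Type*}

/-- All variables of the formula, free or bound, are below `N`, and its quantifier rank is at
most `n`. -/
def Bounded (N : ℕ) : ℕ → FC α → Prop
  | _, atom x y z => x.Below N ∧ y.Below N ∧ z.Below N
  | n, and φ ψ => φ.Bounded N n ∧ ψ.Bounded N n
  | n, or φ ψ => φ.Bounded N n ∧ ψ.Bounded N n
  | n, not φ => φ.Bounded N n
  | n, all i φ => i < N ∧ ∃ m, n = m + 1 ∧ φ.Bounded N m
  | n, ex i φ => i < N ∧ ∃ m, n = m + 1 ∧ φ.Bounded N m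

theorem _root_.FCTerm.exists_below (t : FCTerm α) : ∃ N, ∀ M ≥ N, t.Below M := by
  cases t with
  | var i => exact ⟨i + 1, fun M hM => hM⟩
  | letter a => exact ⟨0, fun _ _ => trivial⟩
  | eps => exact ⟨0, fun _ _ => trivial⟩

theorem exists_bounded (φ : FC α) : ∃ K, ∀ N ≥ K, ∀ n ≥ K, φ.Bounded N n := by
  induction φ with
  | atom x y z =>
    obtain ⟨a, ha⟩ := x.exists_below
    obtain ⟨b, hb⟩ := y.exists_below
    obtain ⟨c, hc⟩ := z.exists_below
    exact ⟨a + b + c, fun N hN n _ => ⟨ha N (by omega), hb N (by omega), hc N (by omega)⟩⟩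
  | and φ ψ ihφ ihψ | or φ ψ ihφ ihψ =>
    obtain ⟨K, hK⟩ := ihφ
    obtain ⟨L, hL⟩ := ihψ
    exact ⟨K + L, fun N hN n hn =>
      ⟨hK N (by omega) n (by omega), hL N (by omega) n (by omega)⟩⟩
  | not φ ih => exact ih
  | all i φ ih | ex i φ ih =>
    obtain ⟨K, hK⟩ := ih
    exact ⟨K + i + 1, fun N hN n hn =>
      ⟨by omega, n - 1, by omega, hK N (by omega) (n - 1) (by omega)⟩⟩

/-- If `x` and `x'` have only short factors in common with `y`, then a formula cannot distinguish
`x y` from `x' y` if it cannot distinguish the types of `x` and `x'`. -/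
theorem sat_append_iff {N r : ℕ} {x x' y : List α} (hr : 1 ≤ r)
    (hgap : ∀ s, s <:+: x → s <:+: y → s.length ≤ r)
    (hgap' : ∀ s, s <:+: x' → s <:+: y → s.length ≤ r) (φ : FC α) :
    ∀ {n : ℕ} {τ τ' ρ : ℕ → List α} {σ : ℕ → Facs (x ++ y)} {σ' : ℕ → Facs (x' ++ y)},
      φ.Bounded N n → SplitsAs σ τ ρ → SplitsAs σ' τ' ρ →
      rankType N r x n τ = rankType N r x' n τ' → (Sat (x ++ y) σ φ ↔ Sat (x' ++ y) σ' φ) := by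
  induction φ with
  | atom a b c =>
    rintro n τ τ' ρ σ σ' ⟨ha, hb, hc⟩ h h' ht
    have hat := atomicType_eq_of_rankType_eq ht
    exact ⟨h.fcConcat_transfer hr hgap h' hat ha hb hc,
      h'.fcConcat_transfer hr hgap' h hat.symm ha hb hc⟩
  | and φ ψ ihφ ihψ =>
    intro n τ τ' ρ σ σ' hb h h' ht
    exact and_congr (ihφ hb.1 h h' ht) (ihψ hb.2 h h' ht)
  | or φ ψ ihφ ihψ =>
    intro n τ τ' ρ σ σ' hb h h' ht
    exact or_congr (ihφ hb.1 h h' ht) (ihψ hb.2 h h' ht)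
  | not φ ih =>
    intro n τ τ' ρ σ σ' hb h h' ht
    exact not_congr (ih hb h h' ht)
  | all i φ ih =>
    rintro n τ τ' ρ σ σ' ⟨hi, m, rfl, hb⟩ h h' ht
    constructor
    · intro hs z'
      obtain ⟨z, τ₁', τ₁, ρ₁, h₁', h₁, ht₁⟩ := h'.exists_update h ht.symm hi z'
      exact (ih hb h₁ h₁' ht₁.symm).1 (hs z)
    · intro hs z
      obtain ⟨z', τ₁, τ₁', ρ₁, h₁, h₁', ht₁⟩ := h.exists_update h' ht hi z
      exact (ih hb h₁ h₁' ht₁).2 (hs z')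
  | ex i φ ih =>
    rintro n τ τ' ρ σ σ' ⟨hi, m, rfl, hb⟩ h h' ht
    constructor
    · rintro ⟨z, hs⟩
      obtain ⟨z', τ₁, τ₁', ρ₁, h₁, h₁', ht₁⟩ := h.exists_update h' ht hi z
      exact ⟨z', (ih hb h₁ h₁' ht₁).1 hs⟩
    · rintro ⟨z', hs⟩
      obtain ⟨z, τ₁', τ₁, ρ₁, h₁', h₁, ht₁⟩ := h'.exists_update h ht.symm hi z'
      exact ⟨z, (ih hb h₁ h₁' ht₁.symm).2 hs⟩

end FC

theorem mainTheorem2 {α : Type*} [Finite α] (w₁ w₂ w₃ u v : List α) (huv : CoPrimitive u v)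
    (φ : FC α) (hφ : φ.IsSentence) (f : ℕ → ℕ) (hf : Function.Injective f)
    (h : ∀ p : ℕ, w₁ ++ wordPow u p ++ w₂ ++ wordPow v (f p) ++ w₃ ∈ φ.language) :
    ∃ s t : ℕ, f s ≠ t ∧ w₁ ++ wordPow u s ++ w₂ ++ wordPow v t ++ w₃ ∈ φ.language := by
  obtain ⟨K, hK⟩ := φ.exists_bounded
  -- Bounds the common factors of `w₁ uᵖ w₂` and `vᵐ w₃`, uniformly in `p` and `m`.
  set r := w₁.length + w₂.length + w₃.length + 2 * (u.length + v.length) with hr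
  have hpos : 0 < u.length := List.length_pos_iff.2 huv.1.1
  obtain ⟨p, q, hpq, htype⟩ := Finite.exists_ne_map_eq_of_infinite fun p : ℕ =>
    rankType K r (w₁ ++ wordPow u p ++ w₂) K fun _ => []
  refine ⟨q, f p, fun hqp => hpq (hf hqp).symm, ?_⟩
  have hp := h p
  rw [List.append_assoc _ (wordPow v _) w₃] at hp ⊢
  rw [FC.mem_language_iff hφ fun _ => epsFactor _] at hp ⊢
  have hsplit : ∀ x y : List α, SplitsAs (x := x) (y := y) (fun _ => epsFactor _)
      (fun _ => []) fun _ => [] := fun x y =>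
    ⟨fun _ => rfl, fun _ => List.nil_infix, fun _ => List.nil_infix⟩
  exact (φ.sat_append_iff (by omega)
    (fun s h₁ h₂ => huv.length_le_of_infix_append w₁ w₂ w₃ h₁ h₂)
    (fun s h₁ h₂ => huv.length_le_of_infix_append w₁ w₂ w₃ h₁ h₂)
    (hK K le_rfl K le_rfl) (hsplit _ _) (hsplit _ _) htype).1 hp
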